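/- A mass problem is a subset of Baire space $\omega^\omega$. Let $(\Phi_n)_{n\in\omega}$ be the standard enumeration of the Turing functionals. Write $\mathcal X\leq_M\mathcal Y$ if some Turing functional $\Phi$ satisfies $\Phi(\mathcal Y)\subseteq\mathcal X$ (in particular $\Phi(f)$ is total for every $f\in\mathcal Y$). The degree structure $\mathcal M$ of mass problems modulo $\equiv_M$ (the Medvedev lattice) is a Brouwer algebra with join, meet and implication induced by $$\mathcal X\oplus\mathcal Y=\{f\oplus g\mid f\in\mathcal X,\ g\in\mathcal Y\},\qquad \mathcal X\otimes\mathcal Y=\{0^\frown f\mid f\in\mathcal X\}\cup\{1^\frown g\mid g\in\mathcal Y\},$$ $$\mathcal X\to\mathcal Y=\{n^\frown f\mid \forall g\in\mathcal X\ (\Phi_n(f\oplus g)\in\mathcal Y)\},$$ with least element $0$ the degree of $\omega^\omega$ and greatest element $1$ the degree of $\emptyset$. (A Brouwer algebra is a bounded distributive lattice with join $\oplus$, meet $\otimes$ and an operation $\to$ such that $a\oplus c\geq b$ if and only if $c\geq a\to b$.) For $x\leq y$ in a Brouwer algebra, the interval $[x,y]$ is a sublattice, and it is a Brouwer algebra with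 least element $x$, greatest element $y$ and implication $u\to_{[x,y]}v=(u\to v)\oplus x$. An upper implicative semilattice embedding between Brouwer algebras is an injective map preserving $\oplus$, $\to$, $0$ and $1$. A subset $\mathscr C$ of a Brouwer algebra $\mathscr B$ is canonical if (i) every $a\in\mathscr C$ is meet-irreducible, i.e. $a=b\otimes c$ with $b,c\in\mathscr B$ implies $a=b$ or $a=c$; (ii) $\mathscr C$ is closed under $\oplus$ and $\to$; (iii) $a\to(b\otimes c)=(a\to b)\otimes(a\to c)$ for all $a\in\mathscr C$ and $b,c\in\mathscr B$. For $\mathcal X\subseteq\omega^\omega$ let $\overline{\mathcal X}=\omega^\omega\setminus\mathcal X$ and $C(\mathcal X)=\{g\in\omega^\omega\mid\exists h\in\mathcal X\ (g\geq_T h)\}$. **Theorem.** Let $\mathcal B$ and $\mathcal E$ be mass problems with $\mathcal B\not\leq_M\mathcal E$, and let $\mathcal D=\mathcal E\to\mathcal B$. Let $\mathcal A\subseteq\omega^\omega$ be downward closed under Turing reducibility, with $\mathcal E\subseteq\overline{\mathcal A}$. Let $(f_i)_{i\in I}$ be a strong upwards antichain in $\mathcal A$, that is, a family of elements of $\mathcal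 A$ with $f_i\oplus f_j\notin\mathcal A$ whenever $i\neq j$. For $X\subseteq I$ put $$\beta(X)=\bigl(\overline{\mathcal A}\cup C(\{f_i\mid i\in X\})\bigr)\otimes\mathcal D .$$ Then $\beta$ induces an upper implicative semilattice embedding of the Brouwer algebra $(\mathcal P(I),\supseteq)$ into the interval $[\beta(I),\beta(\emptyset)]_{\mathcal M}$ of the Medvedev lattice, and its range is a canonical subset of $[\beta(I),\beta(\emptyset)]_{\mathcal M}$. -/

import Mathlib

open Nat.Partrec (Code)

namespace Medvedev

/-! ### Turing functionals on Baire space -/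

/-- The (partial) Turing functionals: `F f x` is the result, if any, of a fixed oracle computation
with oracle `f : ℕ → ℕ` on input `x`.  These are Mathlib's clauses for `Nat.RecursiveIn {f}`,
read uniformly in the oracle `f`. -/
inductive IsTuringFunctional : ((ℕ → ℕ) → ℕ → Part ℕ) → Prop
  | zero : IsTuringFunctional fun _ _ => Part.some 0
  | succ : IsTuringFunctional fun _ n => Part.some (n + 1)
  | left : IsTuringFunctional fun _ n => Part.some n.unpair.1
  | right : IsTuringFunctional fun _ n => Part.some n.unpair.2
  | oracle : IsTuringFunctional fun f n => Part.some (f n)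
  | pair {F G : (ℕ → ℕ) → ℕ → Part ℕ} : IsTuringFunctional F → IsTuringFunctional G →
      IsTuringFunctional fun f n => Nat.pair <$> F f n <*> G f n
  | comp {F G : (ℕ → ℕ) → ℕ → Part ℕ} : IsTuringFunctional F → IsTuringFunctional G →
      IsTuringFunctional fun f n => G f n >>= F f
  | prec {F G : (ℕ → ℕ) → ℕ → Part ℕ} : IsTuringFunctional F → IsTuringFunctional G →
      IsTuringFunctional fun f p =>
        Nat.rec (motive := fun _ => Part ℕ) (F f p.unpair.1)
          (fun y IH => IH >>= fun i => G f (Nat.pair p.unpair.1 (Nat.pair y i))) p.unpair.2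
  | rfind {F : (ℕ → ℕ) → ℕ → Part ℕ} : IsTuringFunctional F →
      IsTuringFunctional fun f a =>
        Nat.rfind fun n => (fun m => decide (m = 0)) <$> F f (Nat.pair a n)

/-- The initial segment `f(0), …, f(k-1)` of `f`. -/
def initSeg (f : ℕ → ℕ) (k : ℕ) : List ℕ := (List.range k).map f

/-- The standard enumeration `Φ₀, Φ₁, …` of the Turing functionals (see
`isTuringFunctional_iff`): to compute `Φₙ(f)(x)`, run the `n`-th partial computable function on the
inputs `(f ↾ k, x)` for `s` steps, for all pairs `(s, k)` in turn, until an output is found. -/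
def Phi (n : ℕ) (f : ℕ → ℕ) : ℕ → Part ℕ := fun x =>
  Nat.rfindOpt fun t =>
    Code.evaln t.unpair.1 (Denumerable.ofNat Code n)
      (Nat.pair (Encodable.encode (initSeg f t.unpair.2)) x)

/-- `Maps F f g`: the partial function `F(f)` is total and equal to `g`. -/
def Maps (F : (ℕ → ℕ) → ℕ → Part ℕ) (f g : ℕ → ℕ) : Prop := ∀ x, F f x = Part.some (g x)

/-! #### Normal form: the functionals `Phi n` are exactly the Turing functionals -/

theorem initSeg_length (f : ℕ → ℕ) (k : ℕ) : (initSeg f k).length = k := by simp [initSeg]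

theorem initSeg_prefix (f : ℕ → ℕ) {k l : ℕ} (h : k ≤ l) : initSeg f k <+: initSeg f l := by
  obtain ⟨d, rfl⟩ := Nat.exists_eq_add_of_le h
  simp [initSeg, List.range_add]

theorem initSeg_getElem? (f : ℕ → ℕ) (k x y : ℕ) :
    (initSeg f k)[x]? = some y ↔ x < k ∧ f x = y := by
  by_cases h : x < k <;> simp [initSeg, h]

/-- `a` computes `F` by approximations on initial segments of the oracle. -/
structure Approx (F : (ℕ → ℕ) → ℕ → Part ℕ) (a : List ℕ → ℕ → Option ℕ) : Prop where
  prim : Primrec₂ a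
  mono : ∀ {σ τ x y}, σ <+: τ → a σ x = some y → a τ x = some y
  spec : ∀ f x y, y ∈ F f x ↔ ∃ k, a (initSeg f k) x = some y

theorem Approx.mono' {F a} (h : Approx F a) {f : ℕ → ℕ} {k l x y : ℕ} (hkl : k ≤ l)
    (hy : a (initSeg f k) x = some y) : a (initSeg f l) x = some y :=
  h.mono (initSeg_prefix f hkl) hy

theorem approx_const {g : ℕ → ℕ} (hg : Primrec g) :
    Approx (fun _ n => Part.some (g n)) fun _ n => some (g n) where
  prim := Primrec.option_some.comp (hg.comp Primrec.snd)
  mono _ h := h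
  spec f x y := by simp [eq_comm]

theorem approx_oracle : Approx (fun f n => Part.some (f n)) fun σ n => σ[n]? where
  prim := Primrec.list_getElem?
  mono {σ τ x y} h hy := by
    obtain ⟨ρ, rfl⟩ := h
    have := (List.getElem?_eq_some_iff.1 hy).1
    rw [List.getElem?_append_left this, hy]
  spec f x y := by
    simp only [initSeg_getElem?, Part.mem_some_iff]
    constructor
    · rintro rfl; exact ⟨x + 1, by simp⟩
    · rintro ⟨k, -, rfl⟩; rfl

theorem Approx.pair {F G a b} (hF : Approx F a) (hG : Approx G b) :
    Approx (fun f n => Nat.pair <$> F f n <*> G f n)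
      fun σ n => (a σ n).bind fun u => (b σ n).bind fun v => some (Nat.pair u v) where
  prim := by
    refine Primrec.option_bind hF.prim ?_
    refine Primrec.option_bind (hG.prim.comp (Primrec.fst.comp Primrec.fst)
      (Primrec.snd.comp Primrec.fst)) ?_
    exact Primrec.option_some.comp
      (Primrec₂.natPair.comp (Primrec.snd.comp Primrec.fst) Primrec.snd)
  mono {σ τ x y} h hy := by
    simp only [Option.bind_eq_some_iff] at hy ⊢
    obtain ⟨u, hu, v, hv, e⟩ := hy
    exact ⟨u, hF.mono h hu, v, hG.mono h hv, e⟩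
  spec f x y := by
    simp only [Option.bind_eq_some_iff, Seq.seq, Part.map_eq_map, Part.bind_eq_bind, Part.mem_bind_iff,
      Part.mem_map_iff, hF.spec, hG.spec]
    constructor
    · rintro ⟨_, ⟨u, ⟨k, hk⟩, rfl⟩, v, ⟨l, hl⟩, rfl⟩
      exact ⟨max k l, u, hF.mono' (le_max_left _ _) hk, v, hG.mono' (le_max_right _ _) hl, rfl⟩
    · rintro ⟨k, u, hu, v, hv, e⟩
      exact ⟨_, ⟨u, ⟨k, hu⟩, rfl⟩, v, ⟨k, hv⟩, by simpa using e⟩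

theorem Approx.comp {F G a b} (hF : Approx F a) (hG : Approx G b) :
    Approx (fun f n => G f n >>= F f) fun σ n => (b σ n).bind (a σ) where
  prim := Primrec.option_bind hG.prim (hF.prim.comp (Primrec.fst.comp Primrec.fst) Primrec.snd)
  mono {σ τ x y} h hy := by
    simp only [Option.bind_eq_some_iff] at hy ⊢
    obtain ⟨u, hu, hv⟩ := hy
    exact ⟨u, hG.mono h hu, hF.mono h hv⟩
  spec f x y := by
    simp only [Option.bind_eq_some_iff, Part.bind_eq_bind, Part.mem_bind_iff, hF.spec, hG.spec]
    constructor
    · rintro ⟨u, ⟨k, hk⟩, l, hl⟩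
      exact ⟨max k l, u, hG.mono' (le_max_left _ _) hk, hF.mono' (le_max_right _ _) hl⟩
    · rintro ⟨k, u, hu, hv⟩
      exact ⟨u, ⟨k, hu⟩, k, hv⟩

theorem Approx.prec {F G a b} (hF : Approx F a) (hG : Approx G b) :
    Approx (fun f p => Nat.rec (motive := fun _ => Part ℕ) (F f p.unpair.1)
          (fun y IH => IH >>= fun i => G f (Nat.pair p.unpair.1 (Nat.pair y i))) p.unpair.2)
      fun σ p => Nat.rec (motive := fun _ => Option ℕ) (a σ p.unpair.1)
          (fun y IH => IH.bind fun i => b σ (Nat.pair p.unpair.1 (Nat.pair y i))) p.unpair.2 where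
  prim := by
    have hun : Primrec fun q : List ℕ × ℕ => q.2.unpair := Primrec.unpair.comp Primrec.snd
    refine Primrec.nat_rec' (f := fun q : List ℕ × ℕ => q.2.unpair.2)
      (g := fun q => a q.1 q.2.unpair.1)
      (h := fun q s => s.2.bind fun i => b q.1 (Nat.pair q.2.unpair.1 (Nat.pair s.1 i)))
      (Primrec.snd.comp hun) (hF.prim.comp Primrec.fst (Primrec.fst.comp hun)) ?_
    refine Primrec.option_bind (Primrec.snd.comp Primrec.snd) ?_
    refine hG.prim.comp (Primrec.fst.comp (Primrec.fst.comp Primrec.fst)) ?_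
    refine Primrec₂.natPair.comp (Primrec.fst.comp (hun.comp (Primrec.fst.comp Primrec.fst))) ?_
    exact Primrec₂.natPair.comp (Primrec.fst.comp (Primrec.snd.comp Primrec.fst)) Primrec.snd
  mono {σ τ x y} h := by
    induction x.unpair.2 generalizing y with
    | zero => exact fun hy => hF.mono h hy
    | succ n ih =>
      simp only [Option.bind_eq_some_iff]
      rintro ⟨u, hu, hv⟩
      exact ⟨u, ih hu, hG.mono h hv⟩
  spec f x y := by
    have mono' : ∀ {k l : ℕ} (_ : k ≤ l) (n : ℕ) {y},
        Nat.rec (motive := fun _ => Option ℕ) (a (initSeg f k) x.unpair.1)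
          (fun y IH => IH.bind fun i =>
            b (initSeg f k) (Nat.pair x.unpair.1 (Nat.pair y i))) n = some y →
        Nat.rec (motive := fun _ => Option ℕ) (a (initSeg f l) x.unpair.1)
          (fun y IH => IH.bind fun i =>
            b (initSeg f l) (Nat.pair x.unpair.1 (Nat.pair y i))) n = some y := by
      intro k l h n
      induction n with
      | zero => exact fun hy => hF.mono' h hy
      | succ n ih =>
        simp only [Option.bind_eq_some_iff]
        rintro y ⟨u, hu, hv⟩
        exact ⟨u, ih hu, hG.mono' h hv⟩
    induction x.unpair.2 generalizing y with
    | zero => exact hF.spec f _ y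
    | succ n ih =>
      simp only [Part.bind_eq_bind] at ih
      simp only [Option.bind_eq_some_iff, Part.bind_eq_bind, Part.mem_bind_iff, hG.spec, ih]
      constructor
      · rintro ⟨u, ⟨k, hk⟩, l, hl⟩
        exact ⟨max k l, u, mono' (le_max_left _ _) n hk, hG.mono' (le_max_right _ _) hl⟩
      · rintro ⟨k, u, hu, hv⟩
        exact ⟨u, ⟨k, hu⟩, k, hv⟩

/-- Bounded version of the search for the least zero. -/
def searchApprox (a : List ℕ → ℕ → Option ℕ) (σ : List ℕ) (x : ℕ) : Option ℕ :=
  let m := (List.range σ.length).findIdx fun n =>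
    decide ((a σ (Nat.pair x n)).getD 0 = 0)
  if a σ (Nat.pair x m) = some 0 then some m else none

theorem searchApprox_eq_some {a : List ℕ → ℕ → Option ℕ} {σ : List ℕ} {x y : ℕ} :
    searchApprox a σ x = some y ↔ y ≤ σ.length ∧ a σ (Nat.pair x y) = some 0 ∧
      ∀ m < y, ∃ v, a σ (Nat.pair x m) = some (v + 1) := by
  have key : ∀ m, (a σ (Nat.pair x m)).getD 0 ≠ 0 ↔ ∃ v, a σ (Nat.pair x m) = some (v + 1) := by
    intro m
    rcases a σ (Nat.pair x m) with _ | _ | v <;> simp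
  unfold searchApprox
  dsimp only
  generalize hm : (List.range σ.length).findIdx
    (fun n => decide ((a σ (Nat.pair x n)).getD 0 = 0)) = m
  have hle : m ≤ σ.length := by
    have := List.findIdx_le_length (xs := List.range σ.length)
      (p := fun n => decide ((a σ (Nat.pair x n)).getD 0 = 0))
    simpa [hm] using this
  have hlt : ∀ i < m, ∃ v, a σ (Nat.pair x i) = some (v + 1) := by
    intro i hi
    rw [← key]
    subst hm
    have := List.not_of_lt_findIdx hi
    simpa using this
  constructor
  · intro h
    split_ifs at h with h0
    obtain rfl : m = y := by simpa using h
    exact ⟨hle, h0, hlt⟩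
  · rintro ⟨hy, h0, hs⟩
    obtain rfl : m = y := by
      rcases lt_trichotomy m y with h | h | h
      · obtain ⟨v, hv⟩ := hs m h
        have hml : m < (List.range σ.length).length := by simpa using lt_of_lt_of_le h hy
        rw [← hm] at hml
        have := List.findIdx_getElem (w := hml)
        simp [hm, hv] at this
      · exact h
      · obtain ⟨v, hv⟩ := hlt y h
        simp [h0] at hv
    simp [h0]

theorem mem_rfind_eq_zero {p : ℕ → Part ℕ} {y : ℕ} :
    (y ∈ Nat.rfind fun n => (fun m => decide (m = 0)) <$> p n) ↔
      0 ∈ p y ∧ ∀ m < y, ∃ v, v + 1 ∈ p m := by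
  refine Nat.mem_rfind.trans (and_congr ?_ (forall_congr' fun m => imp_congr_right fun _ => ?_))
  · refine (Part.mem_map_iff _).trans ⟨?_, fun h => ⟨0, h, by simp⟩⟩
    rintro ⟨u, hu, e⟩
    obtain rfl : u = 0 := by simpa using e
    exact hu
  · refine (Part.mem_map_iff _).trans ⟨?_, fun ⟨v, hv⟩ => ⟨v + 1, hv, by simp⟩⟩
    rintro ⟨u, hu, e⟩
    obtain ⟨v, rfl⟩ := Nat.exists_eq_succ_of_ne_zero (show u ≠ 0 by simpa using e)
    exact ⟨v, hu⟩

theorem Approx.rfind {F a} (hF : Approx F a) :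
    Approx (fun f x => Nat.rfind fun n => (fun m => decide (m = 0)) <$> F f (Nat.pair x n))
      (searchApprox a) where
  prim := by
    have hlen : Primrec fun q : List ℕ × ℕ => List.range q.1.length :=
      Primrec.list_range.comp (Primrec.list_length.comp Primrec.fst)
    have hidx : Primrec fun q : List ℕ × ℕ => (List.range q.1.length).findIdx fun n =>
        decide ((a q.1 (Nat.pair q.2 n)).getD 0 = 0) := by
      refine Primrec.list_findIdx hlen ?_
      refine (PrimrecRel.comp Primrec.eq (f := fun q : (List ℕ × ℕ) × ℕ =>
        (a q.1.1 (Nat.pair q.1.2 q.2)).getD 0) (g := fun _ => 0) ?_ (Primrec.const 0)).decide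
      exact Primrec.option_getD.comp (hF.prim.comp (Primrec.fst.comp Primrec.fst)
        (Primrec₂.natPair.comp (Primrec.snd.comp Primrec.fst) Primrec.snd)) (Primrec.const 0)
    refine Primrec.ite (PrimrecRel.comp Primrec.eq ?_ (Primrec.const (some 0)))
      (Primrec.option_some.comp hidx) (Primrec.const none)
    exact hF.prim.comp Primrec.fst (Primrec₂.natPair.comp Primrec.snd hidx)
  mono {σ τ x y} h := by
    simp only [searchApprox_eq_some]
    rintro ⟨h1, h2, h3⟩
    refine ⟨h1.trans h.length_le, hF.mono h h2, fun m hm => ?_⟩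
    obtain ⟨v, hv⟩ := h3 m hm
    exact ⟨v, hF.mono h hv⟩
  spec f x y := by
    simp only [searchApprox_eq_some, initSeg_length, mem_rfind_eq_zero, hF.spec]
    constructor
    · rintro ⟨⟨k, hk⟩, hs⟩
      have : ∀ z ≤ y, ∃ l, ∀ m < z, ∃ v, a (initSeg f l) (Nat.pair x m) = some (v + 1) := by
        intro z hz
        induction z with
        | zero => exact ⟨0, by simp⟩
        | succ z ih =>
          obtain ⟨l, hl⟩ := ih (by omega)
          obtain ⟨v, k', hk'⟩ := hs z (by omega)
          refine ⟨max l k', fun m hm => ?_⟩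
          rcases Nat.lt_succ_iff_lt_or_eq.1 hm with h | rfl
          · obtain ⟨w, hw⟩ := hl m h
            exact ⟨w, hF.mono' (le_max_left _ _) hw⟩
          · exact ⟨v, hF.mono' (le_max_right _ _) hk'⟩
      obtain ⟨l, hl⟩ := this y le_rfl
      refine ⟨max y (max k l), le_max_left _ _, hF.mono' (by simp) hk, fun m hm => ?_⟩
      obtain ⟨v, hv⟩ := hl m hm
      exact ⟨v, hF.mono' (by simp) hv⟩
    · rintro ⟨k, -, h0, hs⟩
      refine ⟨⟨k, h0⟩, fun m hm => ?_⟩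
      obtain ⟨v, hv⟩ := hs m hm
      exact ⟨v, k, hv⟩

theorem IsTuringFunctional.exists_approx {F} (hF : IsTuringFunctional F) : ∃ a, Approx F a := by
  induction hF with
  | zero => exact ⟨_, approx_const (Primrec.const 0)⟩
  | succ => exact ⟨_, approx_const Primrec.succ⟩
  | left => exact ⟨_, approx_const (Primrec.fst.comp Primrec.unpair)⟩
  | right => exact ⟨_, approx_const (Primrec.snd.comp Primrec.unpair)⟩
  | oracle => exact ⟨_, approx_oracle⟩
  | pair _ _ h1 h2 =>
    obtain ⟨a, ha⟩ := h1; obtain ⟨b, hb⟩ := h2; exact ⟨_, ha.pair hb⟩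
  | comp _ _ h1 h2 =>
    obtain ⟨a, ha⟩ := h1; obtain ⟨b, hb⟩ := h2; exact ⟨_, ha.comp hb⟩
  | prec _ _ h1 h2 =>
    obtain ⟨a, ha⟩ := h1; obtain ⟨b, hb⟩ := h2; exact ⟨_, ha.prec hb⟩
  | rfind _ h1 =>
    obtain ⟨a, ha⟩ := h1; exact ⟨_, ha.rfind⟩

theorem IsTuringFunctional.exists_phi {F} (hF : IsTuringFunctional F) : ∃ n, Phi n = F := by
  obtain ⟨a, ha⟩ := hF.exists_approx
  have hp : Partrec fun z : ℕ => (a ((Encodable.decode (α := List ℕ) z.unpair.1).getD [])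
      z.unpair.2 : Part ℕ) := by
    refine Computable.ofOption (Primrec.to_comp ?_)
    exact ha.prim.comp (Primrec.option_getD.comp
      (Primrec.decode.comp (Primrec.fst.comp Primrec.unpair)) (Primrec.const []))
      (Primrec.snd.comp Primrec.unpair)
  obtain ⟨c, hc⟩ := Code.exists_code.1 (Partrec.nat_iff.1 hp)
  have hev : ∀ σ x y, y ∈ c.eval (Nat.pair (Encodable.encode σ) x) ↔ a σ x = some y := by
    intro σ x y
    rw [hc]
    simp
  refine ⟨Encodable.encode c, ?_⟩
  have fwd : ∀ f x y, y ∈ Phi (Encodable.encode c) f x → y ∈ F f x := by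
    intro f x y h
    obtain ⟨t, ht⟩ := Nat.rfindOpt_spec h
    rw [Denumerable.ofNat_encode] at ht
    exact (ha.spec f x y).2 ⟨_, (hev _ _ _).1 (Code.evaln_sound ht)⟩
  funext f x
  refine Part.ext fun y => ⟨fwd f x y, fun h => ?_⟩
  obtain ⟨k, hk⟩ := (ha.spec f x y).1 h
  obtain ⟨s, hs⟩ := Code.evaln_complete.1 ((hev _ _ _).2 hk)
  have hd : (Phi (Encodable.encode c) f x).Dom := by
    refine Nat.rfindOpt_dom.2 ⟨Nat.pair s k, y, ?_⟩
    simpa using hs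
  have h' := fwd f x _ (Part.get_mem hd)
  have := Part.get_mem hd
  rwa [Part.mem_unique h' h] at this

theorem isTuringFunctional_of_partrec {g : ℕ →. ℕ} (hg : Nat.Partrec g) :
    IsTuringFunctional fun _ => g := by
  induction hg with
  | zero => exact .zero
  | succ => exact .succ
  | left => exact .left
  | right => exact .right
  | pair _ _ h1 h2 => exact .pair h1 h2
  | comp _ _ h1 h2 => exact .comp h1 h2
  | prec _ _ h1 h2 => exact .prec h1 h2
  | rfind _ h1 => exact .rfind h1

theorem isTuringFunctional_of_primrec {g : ℕ → ℕ} (hg : Primrec g) :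
    IsTuringFunctional fun _ n => Part.some (g n) :=
  isTuringFunctional_of_partrec (Nat.Partrec.of_primrec (Primrec.nat_iff.1 hg))

/-- Total functionals `T` with `IsTuringFunctional (fun f n => Part.some (T f n))`. -/
abbrev IsTotalFunctional (T : (ℕ → ℕ) → ℕ → ℕ) : Prop :=
  IsTuringFunctional fun f n => Part.some (T f n)

theorem IsTotalFunctional.pair {S T : (ℕ → ℕ) → ℕ → ℕ} (hS : IsTotalFunctional S)
    (hT : IsTotalFunctional T) : IsTotalFunctional fun f n => Nat.pair (S f n) (T f n) := by
  have := IsTuringFunctional.pair hS hT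
  simpa [Seq.seq] using this

theorem IsTotalFunctional.comp {S T : (ℕ → ℕ) → ℕ → ℕ} (hS : IsTotalFunctional S)
    (hT : IsTotalFunctional T) : IsTotalFunctional fun f n => S f (T f n) := by
  have := IsTuringFunctional.comp hS hT
  simpa using this

theorem IsTotalFunctional.map {g : ℕ → ℕ} {T : (ℕ → ℕ) → ℕ → ℕ} (hg : Primrec g)
    (hT : IsTotalFunctional T) : IsTotalFunctional fun f n => g (T f n) :=
  IsTotalFunctional.comp (S := fun _ => g) (isTuringFunctional_of_primrec hg) hT

theorem IsTotalFunctional.precomp {g : ℕ → ℕ} {T : (ℕ → ℕ) → ℕ → ℕ} (hT : IsTotalFunctional T)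
    (hg : Primrec g) : IsTotalFunctional fun f n => T f (g n) :=
  IsTotalFunctional.comp (T := fun _ => g) hT (isTuringFunctional_of_primrec hg)

theorem isTotalFunctional_initSeg :
    IsTotalFunctional fun f k => Encodable.encode (initSeg f k) := by
  let step : ℕ → ℕ := fun q => Encodable.encode
    (((Encodable.decode (α := List ℕ) q.unpair.1).getD []) ++ [q.unpair.2])
  have hstep : Primrec step := by
    refine Primrec.encode.comp (Primrec.list_concat.comp (Primrec.option_getD.comp
      (Primrec.decode.comp (Primrec.fst.comp Primrec.unpair)) (Primrec.const []))
      (Primrec.snd.comp Primrec.unpair))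
  have hyi : Primrec fun z : ℕ => z.unpair.2.unpair.1 :=
    Primrec.fst.comp (Primrec.unpair.comp (Primrec.snd.comp Primrec.unpair))
  have hii : Primrec fun z : ℕ => z.unpair.2.unpair.2 :=
    Primrec.snd.comp (Primrec.unpair.comp (Primrec.snd.comp Primrec.unpair))
  have hG : IsTotalFunctional fun f z => step (Nat.pair z.unpair.2.unpair.2 (f z.unpair.2.unpair.1)) :=
    IsTotalFunctional.map hstep (IsTotalFunctional.pair (isTuringFunctional_of_primrec hii)
      (IsTotalFunctional.precomp .oracle hyi))
  have hF : IsTotalFunctional fun _ _ => Encodable.encode ([] : List ℕ) :=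
    isTuringFunctional_of_primrec (Primrec.const _)
  have h1 := IsTuringFunctional.prec hF hG
  have h2 := IsTuringFunctional.comp h1
    (isTuringFunctional_of_primrec (Primrec₂.natPair.comp (Primrec.const 0) Primrec.id))
  convert h2 using 3 with f k
  simp only [Part.bind_eq_bind, Part.bind_some, Nat.unpair_pair, id]
  induction k with
  | zero => rfl
  | succ k ih =>
    dsimp only
    rw [← ih]
    simp [step, initSeg, List.range_succ]

theorem isTuringFunctional_phi_uniform :
    IsTuringFunctional fun f p => Phi p.unpair.1 f p.unpair.2 := by
  let ev : ℕ → Option ℕ := fun q =>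
    Code.evaln q.unpair.1 (Denumerable.ofNat Code q.unpair.2.unpair.1) q.unpair.2.unpair.2
  have hr : Primrec fun q : ℕ => q.unpair.2.unpair :=
    Primrec.unpair.comp (Primrec.snd.comp Primrec.unpair)
  have hev : Primrec ev := Code.primrec_evaln.comp
    (Primrec.pair (Primrec.pair (Primrec.fst.comp Primrec.unpair)
      ((Primrec.ofNat Code).comp (Primrec.fst.comp hr))) (Primrec.snd.comp hr))
  let T : (ℕ → ℕ) → ℕ → ℕ := fun f z => Nat.pair z.unpair.2.unpair.1
    (Nat.pair z.unpair.1.unpair.1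
      (Nat.pair (Encodable.encode (initSeg f z.unpair.2.unpair.2)) z.unpair.1.unpair.2))
  have hl : Primrec fun q : ℕ => q.unpair.1.unpair :=
    Primrec.unpair.comp (Primrec.fst.comp Primrec.unpair)
  have hT : IsTotalFunctional T := by
    refine IsTotalFunctional.pair (isTuringFunctional_of_primrec (Primrec.fst.comp hr)) ?_
    refine IsTotalFunctional.pair (isTuringFunctional_of_primrec (Primrec.fst.comp hl)) ?_
    refine IsTotalFunctional.pair ?_ (isTuringFunctional_of_primrec (Primrec.snd.comp hl))
    exact IsTotalFunctional.precomp isTotalFunctional_initSeg (Primrec.snd.comp hr)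
  let test : ℕ → ℕ := fun q => if (ev q).isSome then 0 else 1
  have htest : Primrec test := by
    refine Primrec.ite ?_ (Primrec.const 0) (Primrec.const 1)
    exact PrimrecRel.comp Primrec.eq (Primrec.option_isSome.comp hev) (Primrec.const true)
  have hA := IsTuringFunctional.rfind (IsTotalFunctional.map htest hT)
  let fin : ℕ → ℕ := fun q => (ev q).getD 0
  have hfin : Primrec fin := Primrec.option_getD.comp hev (Primrec.const 0)
  have hid : IsTuringFunctional fun _ n => Part.some n := isTuringFunctional_of_primrec Primrec.id
  have hB := IsTuringFunctional.comp (IsTotalFunctional.map hfin hT) (IsTuringFunctional.pair hid hA)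
  convert hB using 3 with f p
  have hpr : (fun n => Part.some (decide (test (T f (Nat.pair p n)) = 0))) =
      fun n => (((some (ev (T f (Nat.pair p n))).isSome : Option Bool)) : Part Bool) := by
    funext n
    refine congrArg Part.some ?_
    cases h : (ev (T f (Nat.pair p n))).isSome <;> simp [test, h]
  have hphi : Phi p.unpair.1 f p.unpair.2 = Nat.rfindOpt fun t => ev (T f (Nat.pair p t)) := by
    simp [Phi, ev, T]
  rw [hphi]
  simp only [Part.map_eq_map, Seq.seq, Part.map_some, Part.bind_eq_bind, Part.bind_some,
    Nat.rfindOpt]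
  have hpr' := congrArg Nat.rfind hpr
  refine Part.ext fun y => ?_
  simp only [Part.mem_bind_iff, Part.mem_map_iff]
  constructor
  · rintro ⟨n, hn, hy⟩
    refine ⟨_, ⟨n, hpr' ▸ hn, rfl⟩, ?_⟩
    have hy' : ev (T f (Nat.pair p n)) = some y := by simpa using hy
    simp [fin, hy']
  · rintro ⟨_, ⟨n, hn, rfl⟩, hy⟩
    replace hn := hpr' ▸ hn
    refine ⟨n, hn, ?_⟩
    have hs : (ev (T f (Nat.pair p n))).isSome := (Part.mem_some_iff.1 (Nat.rfind_spec hn)).symm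
    obtain ⟨v, hv⟩ := Option.isSome_iff_exists.1 hs
    have : y = v := by simpa [fin, hv] using hy
    simp [hv, this]

/-- `Phi` enumerates exactly the Turing functionals. -/
theorem isTuringFunctional_iff {F : (ℕ → ℕ) → ℕ → Part ℕ} :
    IsTuringFunctional F ↔ ∃ n, Phi n = F := by
  refine ⟨fun h => h.exists_phi, ?_⟩
  rintro ⟨n, rfl⟩
  have := IsTuringFunctional.comp isTuringFunctional_phi_uniform
    (isTuringFunctional_of_primrec (Primrec₂.natPair.comp (Primrec.const n) Primrec.id))
  simpa using this

/-- Substitution of a functional, total on the relevant oracles, into another one. -/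
theorem IsTuringFunctional.subst {F G : (ℕ → ℕ) → ℕ → Part ℕ} (hF : IsTuringFunctional F)
    (hG : IsTuringFunctional G) :
    ∃ H, IsTuringFunctional H ∧ ∀ f g, Maps G f g → H f = F g := by
  induction hF with
  | zero => exact ⟨_, .zero, fun _ _ _ => rfl⟩
  | succ => exact ⟨_, .succ, fun _ _ _ => rfl⟩
  | left => exact ⟨_, .left, fun _ _ _ => rfl⟩
  | right => exact ⟨_, .right, fun _ _ _ => rfl⟩
  | oracle => exact ⟨G, hG, fun f g h => funext h⟩
  | pair _ _ h1 h2 =>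
    obtain ⟨A, hA, hA'⟩ := h1; obtain ⟨B, hB, hB'⟩ := h2
    exact ⟨_, .pair hA hB, fun f g h => by simp only [hA' f g h, hB' f g h]⟩
  | comp _ _ h1 h2 =>
    obtain ⟨A, hA, hA'⟩ := h1; obtain ⟨B, hB, hB'⟩ := h2
    exact ⟨_, .comp hA hB, fun f g h => by simp only [hA' f g h, hB' f g h]⟩
  | prec _ _ h1 h2 =>
    obtain ⟨A, hA, hA'⟩ := h1; obtain ⟨B, hB, hB'⟩ := h2
    exact ⟨_, .prec hA hB, fun f g h => by simp only [hA' f g h, hB' f g h]⟩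
  | rfind _ h1 =>
    obtain ⟨A, hA, hA'⟩ := h1
    exact ⟨_, .rfind hA, fun f g h => by simp only [hA' f g h]⟩

/-! ### Mass problems and Medvedev reducibility -/

/-- `f ⊕ g`: `f` on the even numbers, `g` on the odd numbers. -/
def oplus (f g : ℕ → ℕ) : ℕ → ℕ := fun x => if x % 2 = 0 then f (x / 2) else g (x / 2)

/-- `n ⌢ f`. -/
def cons (n : ℕ) (f : ℕ → ℕ) : ℕ → ℕ
  | 0 => n
  | x + 1 => f x

/-- `A ≤_M B`: some Turing functional `F` satisfies `F(B) ⊆ A`. -/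
def MedvedevLE (A B : Set (ℕ → ℕ)) : Prop :=
  ∃ F, IsTuringFunctional F ∧ ∀ f ∈ B, ∃ g ∈ A, Maps F f g

/-- `A ⊕ B = {f ⊕ g | f ∈ A, g ∈ B}`. -/
def join (A B : Set (ℕ → ℕ)) : Set (ℕ → ℕ) := {h | ∃ f ∈ A, ∃ g ∈ B, h = oplus f g}

/-- `A ⊗ B = 0 ⌢ A ∪ 1 ⌢ B`. -/
def meet (A B : Set (ℕ → ℕ)) : Set (ℕ → ℕ) :=
  {h | (∃ f ∈ A, h = cons 0 f) ∨ ∃ g ∈ B, h = cons 1 g}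

/-- `A → B = {n ⌢ f | ∀ g ∈ A, Φₙ(f ⊕ g) ∈ B}`. -/
def imp (A B : Set (ℕ → ℕ)) : Set (ℕ → ℕ) :=
  {h | ∃ n f, h = cons n f ∧ ∀ g ∈ A, ∃ k ∈ B, Maps (Phi n) (oplus f g) k}

theorem medvedevLE_of_total {A B : Set (ℕ → ℕ)} {T : (ℕ → ℕ) → ℕ → ℕ} (hT : IsTotalFunctional T)
    (h : ∀ f ∈ B, T f ∈ A) : MedvedevLE A B :=
  ⟨_, hT, fun f hf => ⟨T f, h f hf, fun _ => rfl⟩⟩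

theorem medvedevLE_of_subset {A B : Set (ℕ → ℕ)} (h : B ⊆ A) : MedvedevLE A B :=
  medvedevLE_of_total .oracle h

theorem MedvedevLE.refl (A : Set (ℕ → ℕ)) : MedvedevLE A A := medvedevLE_of_subset subset_rfl

theorem MedvedevLE.trans {A B C : Set (ℕ → ℕ)} (h1 : MedvedevLE A B) (h2 : MedvedevLE B C) :
    MedvedevLE A C := by
  obtain ⟨F, hF, hF'⟩ := h1
  obtain ⟨G, hG, hG'⟩ := h2
  obtain ⟨H, hH, hH'⟩ := hF.subst hG
  refine ⟨H, hH, fun f hf => ?_⟩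
  obtain ⟨g, hg, hfg⟩ := hG' f hf
  obtain ⟨k, hk, hgk⟩ := hF' g hg
  exact ⟨k, hk, fun x => by rw [hH' f g hfg, hgk x]⟩

theorem oplus_left (f g : ℕ → ℕ) : (fun x => oplus f g (2 * x)) = f := by
  funext x; simp [oplus]

theorem oplus_right (f g : ℕ → ℕ) : (fun x => oplus f g (2 * x + 1)) = g := by
  funext x
  have h1 : (2 * x + 1) % 2 = 1 := by omega
  have h2 : (2 * x + 1) / 2 = x := by omega
  simp [oplus, h1, h2]

theorem primrec_two_mul : Primrec fun x : ℕ => 2 * x :=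
  Primrec.nat_mul.comp (Primrec.const 2) Primrec.id

theorem isTotalFunctional_left : IsTotalFunctional fun h x => h (2 * x) :=
  IsTotalFunctional.precomp .oracle primrec_two_mul

theorem isTotalFunctional_right : IsTotalFunctional fun h x => h (2 * x + 1) :=
  IsTotalFunctional.precomp .oracle (Primrec.succ.comp primrec_two_mul)

theorem left_le_join (A B : Set (ℕ → ℕ)) : MedvedevLE A (join A B) := by
  refine medvedevLE_of_total isTotalFunctional_left ?_
  rintro _ ⟨f, hf, g, hg, rfl⟩
  rwa [oplus_left]

theorem right_le_join (A B : Set (ℕ → ℕ)) : MedvedevLE B (join A B) := by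
  refine medvedevLE_of_total isTotalFunctional_right ?_
  rintro _ ⟨f, hf, g, hg, rfl⟩
  rwa [oplus_right]

/-- Combine two functionals by `oplus`. -/
theorem IsTuringFunctional.oplus {F G : (ℕ → ℕ) → ℕ → Part ℕ} (hF : IsTuringFunctional F)
    (hG : IsTuringFunctional G) : ∃ H, IsTuringFunctional H ∧
      ∀ f g k, Maps F f g → Maps G f k → Maps H f (oplus g k) := by
  let sel : ℕ → ℕ := fun q =>
    if q.unpair.1 % 2 = 0 then q.unpair.2.unpair.1 else q.unpair.2.unpair.2
  have hr : Primrec fun q : ℕ => q.unpair.2.unpair :=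
    Primrec.unpair.comp (Primrec.snd.comp Primrec.unpair)
  have hsel : Primrec sel := by
    refine Primrec.ite ?_ (Primrec.fst.comp hr) (Primrec.snd.comp hr)
    exact PrimrecRel.comp Primrec.eq (Primrec.nat_mod.comp (Primrec.fst.comp Primrec.unpair)
      (Primrec.const 2)) (Primrec.const 0)
  have hhalf : IsTotalFunctional fun _ x => x / 2 :=
    isTuringFunctional_of_primrec (Primrec.nat_div.comp Primrec.id (Primrec.const 2))
  have hid : IsTotalFunctional fun _ x => x := isTuringFunctional_of_primrec Primrec.id
  refine ⟨_, .comp (isTuringFunctional_of_primrec hsel)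
    (.pair hid (.pair (.comp hF hhalf) (.comp hG hhalf))), fun f g k h1 h2 x => ?_⟩
  have e1 := h1 (x / 2)
  have e2 := h2 (x / 2)
  simp [Seq.seq, e1, e2, sel, Medvedev.oplus]

theorem join_le {A B C : Set (ℕ → ℕ)} (h1 : MedvedevLE A C) (h2 : MedvedevLE B C) :
    MedvedevLE (join A B) C := by
  obtain ⟨F, hF, hF'⟩ := h1
  obtain ⟨G, hG, hG'⟩ := h2
  obtain ⟨H, hH, hH'⟩ := hF.oplus hG
  refine ⟨H, hH, fun f hf => ?_⟩
  obtain ⟨g, hg, hfg⟩ := hF' f hf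
  obtain ⟨k, hk, hfk⟩ := hG' f hf
  exact ⟨_, ⟨g, hg, k, hk, rfl⟩, hH' f g k hfg hfk⟩

theorem isTotalFunctional_cons (n : ℕ) : IsTotalFunctional fun f => cons n f := by
  let sel : ℕ → ℕ := fun q => if q.unpair.1 = 0 then n else q.unpair.2
  have hsel : Primrec sel := by
    refine Primrec.ite ?_ (Primrec.const n) (Primrec.snd.comp Primrec.unpair)
    exact PrimrecRel.comp Primrec.eq (Primrec.fst.comp Primrec.unpair) (Primrec.const 0)
  have h : IsTotalFunctional fun f x => sel (Nat.pair x (f (x - 1))) :=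
    IsTotalFunctional.map hsel (IsTotalFunctional.pair (isTuringFunctional_of_primrec Primrec.id)
      (IsTotalFunctional.precomp .oracle (Primrec.nat_sub.comp Primrec.id (Primrec.const 1))))
  convert h using 4 with f x
  rcases x with _ | x <;> simp [sel, cons]

theorem meet_le_left (A B : Set (ℕ → ℕ)) : MedvedevLE (meet A B) A :=
  medvedevLE_of_total (isTotalFunctional_cons 0) fun f hf => Or.inl ⟨f, hf, rfl⟩

theorem meet_le_right (A B : Set (ℕ → ℕ)) : MedvedevLE (meet A B) B :=
  medvedevLE_of_total (isTotalFunctional_cons 1) fun f hf => Or.inr ⟨f, hf, rfl⟩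

/-- Run the functional whose index is computed from the oracle on an oracle computed from it. -/
theorem exists_phi_eval {N : (ℕ → ℕ) → ℕ} {T : (ℕ → ℕ) → ℕ → ℕ}
    (hN : IsTotalFunctional fun h _ => N h) (hT : IsTotalFunctional T) :
    ∃ H, IsTuringFunctional H ∧ ∀ h, H h = Phi (N h) (T h) := by
  obtain ⟨H, hH, hH'⟩ := isTuringFunctional_phi_uniform.subst hT
  refine ⟨_, .comp hH (IsTotalFunctional.pair hN (isTuringFunctional_of_primrec Primrec.id)),
    fun h => ?_⟩
  funext x
  simp [hH' h (T h) fun _ => rfl]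

theorem isTotalFunctional_tail : IsTotalFunctional fun h x => h (x + 1) :=
  IsTotalFunctional.precomp .oracle Primrec.succ

theorem cons_tail (n : ℕ) (f : ℕ → ℕ) : (fun x => cons n f (x + 1)) = f := rfl

theorem le_meet {A B C : Set (ℕ → ℕ)} (h1 : MedvedevLE C A) (h2 : MedvedevLE C B) :
    MedvedevLE C (meet A B) := by
  obtain ⟨F, hF, hF'⟩ := h1
  obtain ⟨G, hG, hG'⟩ := h2
  obtain ⟨m, rfl⟩ := hF.exists_phi
  obtain ⟨n, rfl⟩ := hG.exists_phi
  have hN : IsTotalFunctional fun h _ => if h 0 = 0 then m else n := by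
    have : Primrec fun q : ℕ => if q = 0 then m else n :=
      Primrec.ite (PrimrecRel.comp Primrec.eq Primrec.id (Primrec.const 0)) (Primrec.const m)
        (Primrec.const n)
    exact IsTotalFunctional.map this (IsTotalFunctional.precomp .oracle (Primrec.const 0))
  obtain ⟨H, hH, hH'⟩ := exists_phi_eval hN isTotalFunctional_tail
  refine ⟨H, hH, ?_⟩
  rintro _ (⟨f, hf, rfl⟩ | ⟨f, hf, rfl⟩)
  · obtain ⟨g, hg, hfg⟩ := hF' f hf
    refine ⟨g, hg, fun x => ?_⟩
    rw [hH']
    exact hfg x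
  · obtain ⟨g, hg, hfg⟩ := hG' f hf
    refine ⟨g, hg, fun x => ?_⟩
    rw [hH']
    exact hfg x

/-- The adjunction that makes `imp` the Brouwer implication. -/
theorem imp_le_iff {A B C : Set (ℕ → ℕ)} : MedvedevLE (imp A B) C ↔ MedvedevLE B (join A C) := by
  constructor
  · intro h
    have hle : MedvedevLE (join (imp A B) A) (join A C) :=
      join_le (h.trans (right_le_join A C)) (left_le_join A C)
    refine MedvedevLE.trans ?_ hle
    have hT : IsTotalFunctional fun h => oplus (fun x => h (2 * (x + 1))) fun x => h (2 * x + 1) := by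
      let sel : ℕ → ℕ := fun x => if x % 2 = 0 then 2 * (x / 2 + 1) else 2 * (x / 2) + 1
      have hd : Primrec fun x : ℕ => x / 2 := Primrec.nat_div.comp Primrec.id (Primrec.const 2)
      have hsel : Primrec sel := Primrec.ite (PrimrecRel.comp Primrec.eq
        (Primrec.nat_mod.comp Primrec.id (Primrec.const 2)) (Primrec.const 0))
        (primrec_two_mul.comp (Primrec.succ.comp hd))
        (Primrec.succ.comp (primrec_two_mul.comp hd))
      have := IsTotalFunctional.precomp .oracle hsel
      convert this using 4 with h x
      by_cases hx : x % 2 = 0 <;> simp [oplus, sel, hx]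
    obtain ⟨H, hH, hH'⟩ := exists_phi_eval
      (N := fun h => h 0) (IsTotalFunctional.precomp .oracle (Primrec.const 0)) hT
    refine ⟨H, hH, ?_⟩
    rintro _ ⟨_, ⟨n, f, rfl, hn⟩, g, hg, rfl⟩
    obtain ⟨k, hk, hm⟩ := hn g hg
    refine ⟨k, hk, fun x => ?_⟩
    rw [hH', oplus_right]
    have e : (fun x => oplus (cons n f) g (2 * (x + 1))) = f := by
      have := oplus_left (cons n f) g
      funext x
      exact congrFun this (x + 1)
    rw [e]
    exact hm x
  · intro h
    have hle : MedvedevLE B (join C A) :=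
      h.trans (join_le (right_le_join C A) (left_le_join C A))
    obtain ⟨F, hF, hF'⟩ := hle
    obtain ⟨n, rfl⟩ := hF.exists_phi
    refine medvedevLE_of_total (isTotalFunctional_cons n) fun f hf => ⟨n, f, rfl, fun g hg => ?_⟩
    exact hF' _ ⟨f, hf, g, hg, rfl⟩

theorem join_mono {A A' B B' : Set (ℕ → ℕ)} (h1 : MedvedevLE A A') (h2 : MedvedevLE B B') :
    MedvedevLE (join A B) (join A' B') :=
  join_le (h1.trans (left_le_join _ _)) (h2.trans (right_le_join _ _))

theorem meet_mono {A A' B B' : Set (ℕ → ℕ)} (h1 : MedvedevLE A A') (h2 : MedvedevLE B B') :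
    MedvedevLE (meet A B) (meet A' B') :=
  le_meet ((meet_le_left _ _).trans h1) ((meet_le_right _ _).trans h2)

theorem imp_mono {A A' B B' : Set (ℕ → ℕ)} (h1 : MedvedevLE A' A) (h2 : MedvedevLE B B') :
    MedvedevLE (imp A B) (imp A' B') :=
  imp_le_iff.2 (h2.trans ((imp_le_iff.1 (MedvedevLE.refl _)).trans
    (join_mono h1 (MedvedevLE.refl _))))

/-! ### The Medvedev lattice -/

/-- Medvedev equivalence `A ≡_M B`. -/
def medvedevSetoid : Setoid (Set (ℕ → ℕ)) where
  r A B := MedvedevLE A B ∧ MedvedevLE B A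
  iseqv := ⟨fun A => ⟨.refl A, .refl A⟩, fun h => ⟨h.2, h.1⟩,
    fun h1 h2 => ⟨h1.1.trans h2.1, h2.2.trans h1.2⟩⟩

/-- The Medvedev degrees. -/
def MedvedevDegree : Type := Quotient medvedevSetoid

/-- The Medvedev degree of a mass problem. -/
def deg (A : Set (ℕ → ℕ)) : MedvedevDegree := Quotient.mk medvedevSetoid A

/-- The Medvedev lattice as a Brouwer algebra (`CoheytingAlgebra` in Mathlib, where `b \ a` is the
Brouwer implication `a → b`, the least `c` with `a ⊔ c ≥ b`): order and operations are induced by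
those on mass problems. -/
instance : CoheytingAlgebra MedvedevDegree where
  le := Quotient.lift₂ MedvedevLE fun _ _ _ _ h1 h2 => propext
    ⟨fun h => (h1.2.trans h).trans h2.1, fun h => (h1.1.trans h).trans h2.2⟩
  le_refl := by rintro ⟨A⟩; exact MedvedevLE.refl A
  le_trans := by rintro ⟨A⟩ ⟨B⟩ ⟨C⟩; exact MedvedevLE.trans
  le_antisymm := by rintro ⟨A⟩ ⟨B⟩ h1 h2; exact Quotient.sound ⟨h1, h2⟩
  sup := Quotient.map₂ join fun _ _ h1 _ _ h2 => ⟨join_mono h1.1 h2.1, join_mono h1.2 h2.2⟩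
  le_sup_left := by rintro ⟨A⟩ ⟨B⟩; exact left_le_join A B
  le_sup_right := by rintro ⟨A⟩ ⟨B⟩; exact right_le_join A B
  sup_le := by rintro ⟨A⟩ ⟨B⟩ ⟨C⟩; exact join_le
  inf := Quotient.map₂ meet fun _ _ h1 _ _ h2 => ⟨meet_mono h1.1 h2.1, meet_mono h1.2 h2.2⟩
  inf_le_left := by rintro ⟨A⟩ ⟨B⟩; exact meet_le_left A B
  inf_le_right := by rintro ⟨A⟩ ⟨B⟩; exact meet_le_right A B
  le_inf := by rintro ⟨A⟩ ⟨B⟩ ⟨C⟩; exact le_meet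
  sdiff b a := Quotient.map₂ imp
    (fun _ _ (h1 : _ ∧ _) _ _ (h2 : _ ∧ _) => ⟨imp_mono h1.2 h2.1, imp_mono h1.1 h2.2⟩) a b
  sdiff_le_iff := by rintro ⟨A⟩ ⟨B⟩ ⟨C⟩; exact imp_le_iff
  bot := deg Set.univ
  bot_le := by rintro ⟨A⟩; exact medvedevLE_of_subset (Set.subset_univ A)
  top := deg ∅
  le_top := by rintro ⟨A⟩; exact medvedevLE_of_subset (Set.empty_subset A)
  hnot a := Quotient.map₂ imp
    (fun _ _ (h1 : _ ∧ _) _ _ (h2 : _ ∧ _) => ⟨imp_mono h1.2 h2.1, imp_mono h1.1 h2.2⟩) a (deg ∅)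
  top_sdiff _ := rfl

theorem deg_le_deg {A B : Set (ℕ → ℕ)} : deg A ≤ deg B ↔ MedvedevLE A B := Iff.rfl
theorem deg_join (A B : Set (ℕ → ℕ)) : deg (join A B) = deg A ⊔ deg B := rfl
theorem deg_meet (A B : Set (ℕ → ℕ)) : deg (meet A B) = deg A ⊓ deg B := rfl
theorem deg_imp (A B : Set (ℕ → ℕ)) : deg (imp A B) = deg B \ deg A := rfl

/-! ### Notions for Brouwer algebras -/

/-- The Brouwer implication `a → b`. -/
abbrev brouwerImp {α : Type*} [CoheytingAlgebra α] (a b : α) : α := b \ a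

/-- The interval `[x, y]` of a Brouwer algebra, as a Brouwer algebra: a sublattice with least
element `x`, greatest element `y` and implication `u →_{[x,y]} v = (u → v) ⊔ x`. -/
abbrev intervalBrouwerAlgebra {α : Type*} [CoheytingAlgebra α] {x y : α} (h : x ≤ y) :
    CoheytingAlgebra (Set.Icc x y) where
  __ := Set.Icc.lattice
  bot := ⟨x, le_rfl, h⟩
  bot_le u := u.2.1
  top := ⟨y, h, le_rfl⟩
  le_top u := u.2.2
  sdiff v u := ⟨brouwerImp u.1 v.1 ⊔ x, le_sup_right, sup_le (sdiff_le.trans v.2.2) h⟩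
  sdiff_le_iff v u w := by
    change brouwerImp u.1 v.1 ⊔ x ≤ w.1 ↔ v.1 ≤ u.1 ⊔ w.1
    rw [sup_le_iff, sdiff_le_iff]
    exact and_iff_left w.2.1
  hnot u := ⟨brouwerImp u.1 y ⊔ x, le_sup_right, sup_le sdiff_le h⟩
  top_sdiff _ := rfl

/-- Upper implicative semilattice embeddings: injective maps preserving `⊕`, `→`, `0` and `1`. -/
structure IsUpperImplicativeEmbedding {α β : Type*} [CoheytingAlgebra α] [CoheytingAlgebra β]
    (φ : α → β) : Prop where
  injective : Function.Injective φ
  map_sup : ∀ a b, φ (a ⊔ b) = φ a ⊔ φ b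
  map_imp : ∀ a b, φ (brouwerImp a b) = brouwerImp (φ a) (φ b)
  map_bot : φ ⊥ = ⊥
  map_top : φ ⊤ = ⊤

/-- Meet-irreducibility.  Unlike Mathlib's `InfIrred`, this does not exclude the top element. -/
def IsMeetIrreducible {α : Type*} [Lattice α] (a : α) : Prop :=
  ∀ b c, a = b ⊓ c → a = b ∨ a = c

/-- Canonical subsets of a Brouwer algebra. -/
structure IsCanonical {α : Type*} [CoheytingAlgebra α] (S : Set α) : Prop where
  meetIrreducible : ∀ a ∈ S, IsMeetIrreducible a
  sup_mem : ∀ a ∈ S, ∀ b ∈ S, a ⊔ b ∈ S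
  imp_mem : ∀ a ∈ S, ∀ b ∈ S, brouwerImp a b ∈ S
  imp_inf : ∀ a ∈ S, ∀ b c, brouwerImp a (b ⊓ c) = brouwerImp a b ⊓ brouwerImp a c

/-! ### Cones, downward closure, antichains -/

/-- `g ≤_T f`, for total functions. -/
abbrev TuringLE (g f : ℕ → ℕ) : Prop := TuringReducible (g : ℕ →. ℕ) (f : ℕ →. ℕ)

/-- Turing reducibility is reducibility through some Turing functional. -/
theorem turingLE_iff {g f : ℕ → ℕ} : TuringLE g f ↔ ∃ F, IsTuringFunctional F ∧ Maps F f g := by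
  constructor
  · intro h
    have key : ∀ k : ℕ →. ℕ, Nat.RecursiveIn {(f : ℕ →. ℕ)} k →
        ∃ F, IsTuringFunctional F ∧ F f = k := by
      intro k hk
      induction hk with
      | zero => exact ⟨_, .zero, rfl⟩
      | succ => exact ⟨_, .succ, rfl⟩
      | left => exact ⟨_, .left, rfl⟩
      | right => exact ⟨_, .right, rfl⟩
      | oracle k hk =>
        obtain rfl : k = (f : ℕ →. ℕ) := hk
        exact ⟨_, .oracle, rfl⟩
      | pair _ _ h1 h2 =>
        obtain ⟨F, hF, rfl⟩ := h1; obtain ⟨G, hG, rfl⟩ := h2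
        exact ⟨_, .pair hF hG, rfl⟩
      | comp _ _ h1 h2 =>
        obtain ⟨F, hF, rfl⟩ := h1; obtain ⟨G, hG, rfl⟩ := h2
        exact ⟨_, .comp hF hG, rfl⟩
      | prec _ _ h1 h2 =>
        obtain ⟨F, hF, rfl⟩ := h1; obtain ⟨G, hG, rfl⟩ := h2
        exact ⟨_, .prec hF hG, rfl⟩
      | rfind _ h1 =>
        obtain ⟨F, hF, rfl⟩ := h1
        exact ⟨_, .rfind hF, rfl⟩
    obtain ⟨F, hF, e⟩ := key _ (RecursiveIn.iff_nat.1 h)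
    exact ⟨F, hF, fun x => by rw [e]; rfl⟩
  · rintro ⟨F, hF, hm⟩
    have key : Nat.RecursiveIn {(f : ℕ →. ℕ)} (F f) := by
      clear hm
      induction hF with
      | zero => exact .zero
      | succ => exact .succ
      | left => exact .left
      | right => exact .right
      | oracle => exact .oracle _ rfl
      | pair _ _ h1 h2 => exact .pair h1 h2
      | comp _ _ h1 h2 => exact .comp h1 h2
      | prec _ _ h1 h2 => exact .prec h1 h2
      | rfind _ h1 => exact .rfind h1
    have e : F f = (g : ℕ →. ℕ) := funext hm
    exact RecursiveIn.iff_nat.2 (e ▸ key)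

/-- The upper cone `C(S) = {f | ∃ g ∈ S, f ≥_T g}`. -/
def upperCone (S : Set (ℕ → ℕ)) : Set (ℕ → ℕ) := {f | ∃ g ∈ S, TuringLE g f}

/-- Downward closure under Turing reducibility. -/
def IsTuringDownwardClosed (A : Set (ℕ → ℕ)) : Prop := ∀ f ∈ A, ∀ g, TuringLE g f → g ∈ A

/-- `(f i)` is a strong upwards antichain in `A`. -/
def IsStrongUpwardsAntichain (A : Set (ℕ → ℕ)) {I : Type*} (f : I → ℕ → ℕ) : Prop :=
  (∀ i, f i ∈ A) ∧ ∀ i j, i ≠ j → oplus (f i) (f j) ∉ A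

/-- `β(X) = (Aᶜ ∪ C({f i | i ∈ X})) ⊗ (E → B)`. -/
def betaProblem (A B E : Set (ℕ → ℕ)) {I : Type*} (f : I → ℕ → ℕ) (X : Set I) : Set (ℕ → ℕ) :=
  meet (Aᶜ ∪ upperCone (f '' X)) (imp E B)

end Medvedev

namespace Medvedev

/-! ### Searching for the least zero of a total functional -/

/-! Write `U_X` for `Aᶜ ∪ C({f i | i ∈ X})` and `D` for `E → B`. The driving fact is that each `U_X`
is closed upwards under Turing reducibility.

Suppose a functional `F` reduces `b ⊗ c` to `U ⊕ W`, with `U` nonempty and upward closed. Given `h ∈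
W`, search for a finite string `σ` such that the first value of `F` on `σ ⊕ h` converges.
Overwriting an initial segment of any `g ∈ U` by `σ` stays in `U`, so the side of the meet reached
is the same for all these modified `g`. Hence `U → (b ⊗ c) = (U → b) ⊗ (U → c)`
(`meet_imp_le_of_meet_le_join`). As the least degree is prime for meets, so is the degree of `U`
(`le_deg_or_le_deg_of_inf_le`).

Joins of upward closed problems are intersections. An element of `A` computes at most one `f i`,
since otherwise some `f i ⊕ f j` with `i ≠ j` would lie in `A`. So `U_X ⊕ U_Y` is equivalent to
`U_{X ∩ Y}`, and `U_X → U_Y` joined with `U_I` to `U_{Xᶜ ∪ Y}`.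

Finally `E ⊆ Aᶜ ⊆ U_X` gives `U_X → D = D`, and `D ≤ U_X` would give `B ≤ E`. These facts let all
properties survive meeting with `D`, by the purely algebraic `embedding_of_prime`. -/

theorem IsTotalFunctional.exists_search {T : (ℕ → ℕ) → ℕ → ℕ} (hT : IsTotalFunctional T) :
    ∃ R, IsTuringFunctional R ∧
      ∀ h, (∃ z, T h z = 0) → ∃ z, T h z = 0 ∧ ∀ x, R h x = Part.some z := by
  -- The search discards the input `x`, so `R h` is constant and its result is available at every
  -- position of a later computation.
  refine ⟨_, .rfind (hT.precomp (Primrec.snd.comp Primrec.unpair)), fun h hz => ?_⟩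
  classical
  refine ⟨Nat.find hz, Nat.find_spec hz, fun x => Part.eq_some_iff.2 (mem_rfind_eq_zero.2 ⟨?_, ?_⟩)⟩
  · simpa using (Nat.find_spec hz).symm
  · intro m hm
    obtain ⟨v, hv⟩ := Nat.exists_eq_succ_of_ne_zero (Nat.find_min hz hm)
    exact ⟨v, by simpa using hv.symm⟩

/-! ### Overwriting an initial segment -/

/-- `g` with its initial segment of length `σ.length` overwritten by `σ`. -/
def overwrite (σ : List ℕ) (g : ℕ → ℕ) : ℕ → ℕ := fun x => (σ[x]?).getD (g x)

/-- The initial segment of `f ⊕ g` of length `σ.length`, where `σ` and `τ` are initial segments of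
`f` and `g` of the same length. -/
def interleave (σ τ : List ℕ) : List ℕ :=
  (List.range σ.length).map fun x => if x % 2 = 0 then σ.getD (x / 2) 0 else τ.getD (x / 2) 0

/-- Positions below `σ.length` of the sum only read positions `x / 2 < σ.length`, so the default `0`
never occurs and the tail of `g` is irrelevant. -/
theorem interleave_initSeg (σ : List ℕ) (g h : ℕ → ℕ) :
    interleave σ (initSeg h σ.length) = initSeg (oplus (overwrite σ g) h) σ.length := by
  refine List.map_congr_left fun x hx => ?_
  have hx : x / 2 < σ.length := by have := List.mem_range.1 hx; omega
  simp [oplus, overwrite, initSeg, hx]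

theorem overwrite_initSeg (g : ℕ → ℕ) (k : ℕ) : overwrite (initSeg g k) g = g := by
  funext x
  by_cases hx : x < k <;> simp [overwrite, initSeg, hx]

theorem overwrite_overwrite (σ : List ℕ) (g : ℕ → ℕ) :
    overwrite (initSeg g σ.length) (overwrite σ g) = g := by
  funext x
  by_cases hx : x < σ.length <;> simp [overwrite, initSeg, hx]

theorem primrec_interleave : Primrec₂ interleave := by
  have hx : Primrec fun q : (List ℕ × List ℕ) × ℕ => q.2 / 2 :=
    Primrec.nat_div.comp Primrec.snd (Primrec.const 2)
  refine Primrec.list_map (Primrec.list_range.comp (Primrec.list_length.comp Primrec.fst)) ?_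
  refine Primrec.ite (PrimrecRel.comp Primrec.eq
    (Primrec.nat_mod.comp Primrec.snd (Primrec.const 2)) (Primrec.const 0)) ?_ ?_
  · exact (Primrec.list_getD 0).comp (Primrec.fst.comp Primrec.fst) hx
  · exact (Primrec.list_getD 0).comp (Primrec.snd.comp Primrec.fst) hx

/-! ### Turing upward closed mass problems -/

/-- Upward closure under Turing reducibility. -/
def IsTuringUpwardClosed (U : Set (ℕ → ℕ)) : Prop := ∀ f ∈ U, ∀ g, TuringLE f g → g ∈ U

theorem TuringLE.of_total {T : (ℕ → ℕ) → ℕ → ℕ} (hT : IsTotalFunctional T) (f : ℕ → ℕ) :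
    TuringLE (T f) f :=
  turingLE_iff.2 ⟨_, hT, fun _ => rfl⟩

theorem turingLE_oplus_left (f g : ℕ → ℕ) : TuringLE f (oplus f g) := by
  have := TuringLE.of_total isTotalFunctional_left (oplus f g)
  rwa [oplus_left] at this

theorem turingLE_oplus_right (f g : ℕ → ℕ) : TuringLE g (oplus f g) := by
  have := TuringLE.of_total isTotalFunctional_right (oplus f g)
  rwa [oplus_right] at this

theorem oplus_turingLE {f g h : ℕ → ℕ} (hf : TuringLE f h) (hg : TuringLE g h) :
    TuringLE (oplus f g) h := by
  obtain ⟨F, hF, hF'⟩ := turingLE_iff.1 hf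
  obtain ⟨G, hG, hG'⟩ := turingLE_iff.1 hg
  obtain ⟨H, hH, hH'⟩ := hF.oplus hG
  exact turingLE_iff.2 ⟨H, hH, hH' h f g hF' hG'⟩

/-- Only finitely many values of `g` are lost; they are hard-wired into the reduction, which need
not be uniform in `g`. -/
theorem turingLE_overwrite (σ : List ℕ) (g : ℕ → ℕ) : TuringLE g (overwrite σ g) := by
  have h : IsTotalFunctional (overwrite (initSeg g σ.length)) := by
    have hsel : Primrec fun q : ℕ => ((initSeg g σ.length)[q.unpair.1]?).getD q.unpair.2 :=
      Primrec.option_getD.comp (Primrec.list_getElem?.comp (Primrec.const _)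
        (Primrec.fst.comp Primrec.unpair)) (Primrec.snd.comp Primrec.unpair)
    have := IsTotalFunctional.map hsel
      (IsTotalFunctional.pair (isTuringFunctional_of_primrec Primrec.id) .oracle)
    simp only [Nat.unpair_pair] at this
    exact this
  have := TuringLE.of_total h (overwrite σ g)
  rwa [overwrite_overwrite] at this

/-- If `b ⊗ c ≤_M U ⊕ W` with `U` upward closed, then finitely much of an element of `U` decides,
uniformly in the element of `W`, which side of `b ⊗ c` is reached. -/
theorem meet_imp_le_of_meet_le_join {U W b c : Set (ℕ → ℕ)} (hU : IsTuringUpwardClosed U)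
    (h : MedvedevLE (meet b c) (join U W)) :
    MedvedevLE (meet (imp U b) (imp U c)) W := by
  -- The search below needs an element of `U` to halt. For empty `U` the join is empty and either
  -- side of the meet will do.
  rcases U.eq_empty_or_nonempty with rfl | ⟨g₀, hg₀⟩
  · refine (meet_le_left _ _).trans (imp_le_iff.2 (medvedevLE_of_subset ?_))
    rintro _ ⟨_, ⟨⟩, _⟩
  obtain ⟨F, hF, hFm⟩ := h
  obtain ⟨a, ha⟩ := hF.exists_approx
  let dec : ℕ → List ℕ := fun n => (Encodable.decode (α := List ℕ) n).getD []
  have hdec : Primrec dec := Primrec.option_getD.comp Primrec.decode (Primrec.const [])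
  have dec_encode : ∀ σ, dec (Encodable.encode σ) = σ := fun σ => by simp [dec]
  -- Here `q` codes `((σ, v), τ)`: does `F` on `σ ⊕ τ` visibly output `v` at input `0`?
  let test : ℕ → ℕ := fun q =>
    if a (interleave (dec q.unpair.1.unpair.1) (dec q.unpair.2)) 0 = some q.unpair.1.unpair.2
    then 0 else 1
  have h1 : Primrec fun q : ℕ => q.unpair.1.unpair :=
    Primrec.unpair.comp (Primrec.fst.comp Primrec.unpair)
  have htest : Primrec test := by
    refine Primrec.ite (PrimrecRel.comp Primrec.eq (ha.prim.comp (primrec_interleave.comp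
      (hdec.comp (Primrec.fst.comp h1)) (hdec.comp (Primrec.snd.comp Primrec.unpair)))
      (Primrec.const 0)) (Primrec.option_some.comp (Primrec.snd.comp h1)))
      (Primrec.const 0) (Primrec.const 1)
  let T : (ℕ → ℕ) → ℕ → ℕ := fun h z =>
    test (Nat.pair z (Encodable.encode (initSeg h (dec z.unpair.1).length)))
  have hT : IsTotalFunctional T := IsTotalFunctional.map htest (IsTotalFunctional.pair
    (isTuringFunctional_of_primrec Primrec.id) (isTotalFunctional_initSeg.precomp
      (Primrec.list_length.comp (hdec.comp (Primrec.fst.comp Primrec.unpair)))))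
  -- The left side does not mention `g`: a successful `z = (σ, v)` forces the first output `v` for
  -- every `g` overwritten by `σ`.
  have hT0 : ∀ h z g, T h z = 0 ↔
      a (initSeg (oplus (overwrite (dec z.unpair.1) g) h) (dec z.unpair.1).length) 0 =
        some z.unpair.2 := by
    intro h z g
    simp [T, test, dec_encode, ← interleave_initSeg]
  obtain ⟨R, hR, hRs⟩ := hT.exists_search
  -- The search halts because a long enough initial segment of `g₀` is a witness.
  have hRW : ∀ h ∈ W, ∃ z, T h z = 0 ∧ ∀ x, R h x = Part.some z := by
    intro h hh
    refine hRs h ?_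
    obtain ⟨y, -, hy⟩ := hFm _ ⟨g₀, hg₀, h, hh, rfl⟩
    obtain ⟨k, hk⟩ := (ha.spec _ 0 (y 0)).1 (by rw [hy 0]; simp)
    refine ⟨Nat.pair (Encodable.encode (initSeg g₀ k)) (y 0), (hT0 _ _ g₀).2 ?_⟩
    simpa [dec_encode, initSeg_length, overwrite_initSeg] using hk
  -- the functional taking `h ⊕ g` to the tail of `F (overwrite σ g ⊕ h)`
  obtain ⟨R', hR', hR's⟩ := hR.subst isTotalFunctional_left
  -- The argument codes `(x, (z, w))`, with `w` the value of `g ⊕ h` at `x`; even positions below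
  -- the length of `σ` are overwritten.
  let selG : ℕ → ℕ := fun q => if q.unpair.1 % 2 = 0
    then ((dec q.unpair.2.unpair.1.unpair.1)[q.unpair.1 / 2]?).getD q.unpair.2.unpair.2
    else q.unpair.2.unpair.2
  have h2 : Primrec fun q : ℕ => q.unpair.2.unpair :=
    Primrec.unpair.comp (Primrec.snd.comp Primrec.unpair)
  have hmod {p : ℕ → ℕ} (hp : Primrec p) : PrimrecPred fun q => p q % 2 = 0 :=
    PrimrecRel.comp Primrec.eq (Primrec.nat_mod.comp hp (Primrec.const 2)) (Primrec.const 0)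
  have hselG : Primrec selG := by
    refine Primrec.ite (hmod (Primrec.fst.comp Primrec.unpair)) ?_ (Primrec.snd.comp h2)
    refine Primrec.option_getD.comp (Primrec.list_getElem?.comp (hdec.comp (Primrec.fst.comp
      (Primrec.unpair.comp (Primrec.fst.comp h2)))) ?_) (Primrec.snd.comp h2)
    exact Primrec.nat_div.comp (Primrec.fst.comp Primrec.unpair) (Primrec.const 2)
  -- Exchanging `2k` and `2k + 1` turns `h ⊕ g` into `g ⊕ h`.
  let swap : ℕ → ℕ := fun x => if x % 2 = 0 then x + 1 else x - 1
  have hswap : Primrec swap := Primrec.ite (hmod Primrec.id) Primrec.succ Primrec.pred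
  have hid : IsTotalFunctional fun _ x => x := isTuringFunctional_of_primrec Primrec.id
  obtain ⟨M₀, hM₀, hM₀s⟩ := hF.subst (IsTuringFunctional.comp
    (isTuringFunctional_of_primrec hselG)
    (.pair hid (.pair hR' (IsTotalFunctional.precomp .oracle hswap))))
  obtain ⟨m, hm⟩ := (IsTuringFunctional.comp hM₀
    (isTuringFunctional_of_primrec Primrec.succ)).exists_phi
  have hΦ : ∀ h z g, (∀ x, R h x = Part.some z) → ∀ x,
      Phi m (oplus h g) x = F (oplus (overwrite (dec z.unpair.1) g) h) (x + 1) := by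
    intro h z g hz x
    rw [hm]
    simp only [Part.bind_eq_bind, Part.bind_some]
    rw [hM₀s (oplus h g) (oplus (overwrite (dec z.unpair.1) g) h)]
    intro x
    have e : R' (oplus h g) x = Part.some z := by
      rw [hR's (oplus h g) h fun x => by rw [← congrFun (oplus_left h g) x], hz]
    rcases Nat.mod_two_eq_zero_or_one x with hx | hx
    · have e1 : (x + 1) % 2 = 1 := by omega
      have e2 : (x + 1) / 2 = x / 2 := by omega
      simp [Seq.seq, e, selG, swap, oplus, overwrite, hx, e1, e2]
    · have e1 : (x - 1) % 2 = 0 := by omega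
      have e2 : (x - 1) / 2 = x / 2 := by omega
      simp [Seq.seq, e, selG, swap, oplus, hx, e1, e2]
  -- The output is the side `v`, then the index `m`, then `h` shifted by two. The same `m` serves
  -- both sides, as it only drops the first value of `F`.
  let selO : ℕ → ℕ := fun q => if q.unpair.1 = 0 then q.unpair.2.unpair.1.unpair.2
    else cons m (fun _ => q.unpair.2.unpair.2) (q.unpair.1 - 1)
  have hselO : Primrec selO := by
    have h3 : Primrec fun q : ℕ => q.unpair.1 - 1 :=
      Primrec.pred.comp (Primrec.fst.comp Primrec.unpair)
    have h4 : Primrec fun q : ℕ => if q.unpair.1 - 1 = 0 then m else q.unpair.2.unpair.2 :=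
      Primrec.ite (PrimrecRel.comp Primrec.eq h3 (Primrec.const 0)) (Primrec.const m)
        (Primrec.snd.comp h2)
    refine Primrec.ite (PrimrecRel.comp Primrec.eq (Primrec.fst.comp Primrec.unpair)
      (Primrec.const 0)) (Primrec.snd.comp (Primrec.unpair.comp (Primrec.fst.comp h2)))
      (h4.of_eq fun q => ?_)
    cases q.unpair.1 - 1 <;> simp [cons]
  refine ⟨_, .comp (isTuringFunctional_of_primrec hselO) (.pair hid (.pair hR
    (IsTotalFunctional.precomp .oracle (Primrec.pred.comp Primrec.pred)))), fun h hh => ?_⟩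
  obtain ⟨z, hz0, hz⟩ := hRW h hh
  refine ⟨cons z.unpair.2 (cons m h), ?_, fun x => ?_⟩
  · have hv : ∀ g ∈ U, ∃ y ∈ meet b c, y 0 = z.unpair.2 ∧
        Maps (Phi m) (oplus h g) fun x => y (x + 1) := by
      intro g hg
      obtain ⟨y, hy, hyF⟩ := hFm _
        ⟨overwrite (dec z.unpair.1) g, hU g hg _ (turingLE_overwrite _ g), h, hh, rfl⟩
      refine ⟨y, hy, ?_, fun x => by rw [hΦ h z g hz, hyF]⟩
      have := (ha.spec _ 0 _).2 ⟨_, (hT0 h z g).1 hz0⟩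
      rw [hyF 0] at this
      exact (Part.mem_some_iff.1 this).symm
    obtain ⟨y₀, hy₀, e₀, -⟩ := hv g₀ hg₀
    have h01 : z.unpair.2 = 0 ∨ z.unpair.2 = 1 := by
      rcases hy₀ with ⟨k, -, rfl⟩ | ⟨k, -, rfl⟩
      exacts [Or.inl e₀.symm, Or.inr e₀.symm]
    rcases h01 with hz2 | hz2
    · refine Or.inl ⟨_, ⟨m, h, rfl, fun g hg => ?_⟩, by rw [hz2]⟩
      obtain ⟨y, hy, e, hmap⟩ := hv g hg
      rcases hy with ⟨k, hk, rfl⟩ | ⟨k, hk, rfl⟩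
      · exact ⟨k, hk, hmap⟩
      · simp [cons, hz2] at e
    · refine Or.inr ⟨_, ⟨m, h, rfl, fun g hg => ?_⟩, by rw [hz2]⟩
      obtain ⟨y, hy, e, hmap⟩ := hv g hg
      rcases hy with ⟨k, hk, rfl⟩ | ⟨k, hk, rfl⟩
      · simp [cons, hz2] at e
      · exact ⟨k, hk, hmap⟩
  · rcases x with _ | _ | x <;> simp [Seq.seq, hz, selO, cons]

/-! ### Implication from, and primeness of, upward closed problems -/

theorem deg_inf_sdiff_of_upwardClosed {U : Set (ℕ → ℕ)} (hU : IsTuringUpwardClosed U)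
    (b c : MedvedevDegree) : (b ⊓ c) \ deg U = b \ deg U ⊓ c \ deg U := by
  refine le_antisymm (le_inf (sdiff_le_sdiff_right inf_le_left)
    (sdiff_le_sdiff_right inf_le_right)) ?_
  induction b using Quotient.inductionOn with | _ b
  induction c using Quotient.inductionOn with | _ c
  -- Take for `W` the least possible problem, `U → (b ⊗ c)` itself.
  exact meet_imp_le_of_meet_le_join hU (imp_le_iff.1 (MedvedevLE.refl (imp U (meet b c))))

/-- The least Medvedev degree is meet-irreducible. -/
theorem le_bot_or_le_bot_of_inf_le_bot {b c : MedvedevDegree} (h : b ⊓ c ≤ ⊥) :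
    b ≤ ⊥ ∨ c ≤ ⊥ := by
  induction b using Quotient.inductionOn with | _ b
  induction c using Quotient.inductionOn with | _ c
  obtain ⟨F, hF, hFm⟩ : MedvedevLE (meet b c) Set.univ := h
  -- Feeding `F` the zero oracle yields one computable element of `b ⊗ c`; its tail lies in `b` or
  -- in `c`, which then has least degree.
  obtain ⟨G, hG, hGs⟩ := hF.subst .zero
  have hG1 : IsTuringFunctional _ := .comp hG .succ
  obtain ⟨y, hy, hyF⟩ := hFm (fun _ => 0) trivial
  have key : ∀ f x, G f x = Part.some (y x) := fun f x => by
    rw [hGs f (fun _ => 0) fun _ => rfl, hyF]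
  rcases hy with ⟨k, hk, rfl⟩ | ⟨k, hk, rfl⟩
  · exact Or.inl ⟨_, hG1, fun f _ => ⟨k, hk, fun x => by simp [key, cons]⟩⟩
  · exact Or.inr ⟨_, hG1, fun f _ => ⟨k, hk, fun x => by simp [key, cons]⟩⟩

/-- The hypothesis makes `U → (b ⊗ c)` least; it splits as a meet, and the least degree is prime. -/
theorem le_deg_or_le_deg_of_inf_le {U : Set (ℕ → ℕ)} (hU : IsTuringUpwardClosed U)
    {b c : MedvedevDegree} (h : b ⊓ c ≤ deg U) : b ≤ deg U ∨ c ≤ deg U := by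
  have := deg_inf_sdiff_of_upwardClosed hU b c
  rw [sdiff_eq_bot_iff.2 h] at this
  simpa only [sdiff_le_iff, sup_bot_eq] using le_bot_or_le_bot_of_inf_le_bot this.ge

/-- The sum `g ⊕ h` computes both parts, so it already belongs to both problems. -/
theorem deg_sup_of_upwardClosed {U V : Set (ℕ → ℕ)} (hU : IsTuringUpwardClosed U)
    (hV : IsTuringUpwardClosed V) : deg U ⊔ deg V = deg (U ∩ V) := by
  refine le_antisymm (sup_le (medvedevLE_of_subset Set.inter_subset_left)
    (medvedevLE_of_subset Set.inter_subset_right)) (medvedevLE_of_subset ?_)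
  rintro _ ⟨g, hg, h, hh, rfl⟩
  exact ⟨hU g hg _ (turingLE_oplus_left g h), hV h hh _ (turingLE_oplus_right g h)⟩

/-! ### The upward closed problems `Aᶜ ∪ C(f '' X)` -/

section Antichain

variable {I : Type*} {A : Set (ℕ → ℕ)} {f : I → ℕ → ℕ} {X Y : Set I}

theorem isTuringUpwardClosed_compl_union_upperCone (hA : IsTuringDownwardClosed A)
    (S : Set (ℕ → ℕ)) : IsTuringUpwardClosed (Aᶜ ∪ upperCone S) := by
  rintro g (hg | ⟨k, hk, hkg⟩) h hgh
  · exact Or.inl fun hh => hg (hA h hh g hgh)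
  · exact Or.inr ⟨k, hk, hkg.trans hgh⟩

theorem IsStrongUpwardsAntichain.eq_of_turingLE (hA : IsTuringDownwardClosed A)
    (hf : IsStrongUpwardsAntichain A f) {i j : I} {h : ℕ → ℕ} (hh : h ∈ A)
    (hi : TuringLE (f i) h) (hj : TuringLE (f j) h) : i = j :=
  by_contra fun hij => hf.2 i j hij (hA h hh _ (oplus_turingLE hi hj))

theorem compl_union_upperCone_inter (hA : IsTuringDownwardClosed A)
    (hf : IsStrongUpwardsAntichain A f) (X Y : Set I) :
    (Aᶜ ∪ upperCone (f '' X)) ∩ (Aᶜ ∪ upperCone (f '' Y)) = Aᶜ ∪ upperCone (f '' (X ∩ Y)) := by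
  refine subset_antisymm ?_ ?_
  · rintro h ⟨hX, hY⟩
    by_cases hh : h ∈ A
    · obtain ⟨_, ⟨i, hi, rfl⟩, hi'⟩ := hX.resolve_left (· hh)
      obtain ⟨_, ⟨j, hj, rfl⟩, hj'⟩ := hY.resolve_left (· hh)
      obtain rfl := hf.eq_of_turingLE hA hh hi' hj'
      exact Or.inr ⟨_, ⟨i, ⟨hi, hj⟩, rfl⟩, hi'⟩
    · exact Or.inl hh
  · rintro h (hh | ⟨_, ⟨i, ⟨hX, hY⟩, rfl⟩, hi⟩)
    · exact ⟨Or.inl hh, Or.inl hh⟩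
    · exact ⟨Or.inr ⟨_, ⟨i, hX, rfl⟩, hi⟩, Or.inr ⟨_, ⟨i, hY, rfl⟩, hi⟩⟩

theorem compl_union_upperCone_mono (h : X ⊆ Y) :
    Aᶜ ∪ upperCone (f '' X) ⊆ Aᶜ ∪ upperCone (f '' Y) :=
  Set.union_subset_union_right _ fun _ ⟨k, hk, hg⟩ => ⟨k, Set.image_mono h hk, hg⟩

/-- For `i ∈ Y`, the reduction sends `f i` into `U_X`, so `f i ∈ U_X`. Being in `A`, it computes
some `f j` with `j ∈ X`, and then `j = i`. -/
theorem subset_of_deg_le (hA : IsTuringDownwardClosed A) (hf : IsStrongUpwardsAntichain A f)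
    (h : deg (Aᶜ ∪ upperCone (f '' X)) ≤ deg (Aᶜ ∪ upperCone (f '' Y))) : Y ⊆ X := by
  intro i hi
  obtain ⟨F, hF, hFm⟩ := deg_le_deg.1 h
  obtain ⟨g, hg, hgi⟩ := hFm (f i) (Or.inr ⟨_, ⟨i, hi, rfl⟩, .refl _⟩)
  have hiX := isTuringUpwardClosed_compl_union_upperCone hA _ g hg (f i)
    (turingLE_iff.2 ⟨F, hF, hgi⟩)
  obtain ⟨_, ⟨j, hj, rfl⟩, hji⟩ := hiX.resolve_left (· (hf.1 i))
  obtain rfl := hf.eq_of_turingLE hA (hf.1 i) (.refl _) hji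
  exact hj

/-- Joining with `U_I` supplies an `h` outside `A` or above some `f i`. If `i ∉ X`, then `h` itself
suffices; if `i ∈ X`, the implication turns `h` into an element of `U_Y`. By upward closure the
identity is the reduction, so the cases need not be decided computably. -/
theorem deg_sdiff_sup_deg_univ (hA : IsTuringDownwardClosed A)
    (hf : IsStrongUpwardsAntichain A f) (X Y : Set I) :
    deg (Aᶜ ∪ upperCone (f '' Y)) \ deg (Aᶜ ∪ upperCone (f '' X)) ⊔
      deg (Aᶜ ∪ upperCone (f '' Set.univ)) = deg (Aᶜ ∪ upperCone (f '' (Xᶜ ∪ Y))) := by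
  have up := fun X => isTuringUpwardClosed_compl_union_upperCone hA (f '' X)
  refine le_antisymm (sup_le ?_ (medvedevLE_of_subset (compl_union_upperCone_mono
    (Set.subset_univ _)))) (medvedevLE_of_subset ?_)
  · rw [sdiff_le_iff, deg_sup_of_upwardClosed (up _) (up _), compl_union_upperCone_inter hA hf]
    refine medvedevLE_of_subset (compl_union_upperCone_mono ?_)
    rintro i ⟨hX, hX' | hY⟩
    exacts [absurd hX hX', hY]
  · rintro _ ⟨_, ⟨n, g, rfl, hn⟩, h, hh, rfl⟩
    have hg : TuringLE (oplus g h) (oplus (cons n g) h) :=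
      oplus_turingLE ((TuringLE.of_total isTotalFunctional_tail (cons n g)).trans
        (turingLE_oplus_left _ _)) (turingLE_oplus_right _ _)
    rcases hh with hh | ⟨_, ⟨i, -, rfl⟩, hi⟩
    · exact up _ h (Or.inl hh) _ (turingLE_oplus_right _ _)
    by_cases hiX : i ∈ X
    · obtain ⟨k, hk, hmap⟩ := hn h (Or.inr ⟨_, ⟨i, hiX, rfl⟩, hi⟩)
      exact up _ k (compl_union_upperCone_mono Set.subset_union_right hk) _
        ((turingLE_iff.2 ⟨_, isTuringFunctional_iff.2 ⟨n, rfl⟩, hmap⟩ : TuringLE k _).trans hg)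
    · exact up _ h (Or.inr ⟨_, ⟨i, Or.inl hiX, rfl⟩, hi⟩) _ (turingLE_oplus_right _ _)

end Antichain

/-! ### Embeddings into intervals of a Brouwer algebra -/

theorem isCanonical_range {α β : Type*} [CoheytingAlgebra α] [CoheytingAlgebra β] {φ : α → β}
    (hφ : IsUpperImplicativeEmbedding φ) (hirr : ∀ a, IsMeetIrreducible (φ a))
    (hinf : ∀ a b c, brouwerImp (φ a) (b ⊓ c) = brouwerImp (φ a) b ⊓ brouwerImp (φ a) c) :
    IsCanonical (Set.range φ) where
  meetIrreducible := by rintro _ ⟨a, rfl⟩; exact hirr a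
  sup_mem := by rintro _ ⟨a, rfl⟩ _ ⟨b, rfl⟩; exact ⟨_, hφ.map_sup a b⟩
  imp_mem := by rintro _ ⟨a, rfl⟩ _ ⟨b, rfl⟩; exact ⟨_, hφ.map_imp a b⟩
  imp_inf := by rintro _ ⟨a, rfl⟩; exact hinf a

/-- Here `u X` stands for the degree of `U_X` and `d` for that of `E → B`. Everything in the
interval is below `d`, where implication from `u X ⊓ d` agrees with implication from `u X`. -/
theorem embedding_of_prime {I α : Type*} [CoheytingAlgebra α] (u : Set I → α) (d : α)
    (prime : ∀ X b c, b ⊓ c ≤ u X → b ≤ u X ∨ c ≤ u X)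
    (inf_sdiff_u : ∀ X b c, (b ⊓ c) \ u X = b \ u X ⊓ c \ u X)
    (u_inter : ∀ X Y, u (X ∩ Y) = u X ⊔ u Y)
    (u_imp : ∀ X Y, u Y \ u X ⊔ u Set.univ = u (Xᶜ ∪ Y))
    (sub : ∀ X Y, u X ≤ u Y → Y ⊆ X)
    (d_sdiff : ∀ X, d \ u X = d) (not_le : ∀ X, ¬ d ≤ u X) :
    ∃ hβ : ∀ X : Set I, u X ⊓ d ∈ Set.Icc (u Set.univ ⊓ d) (u ∅ ⊓ d),
      letI := intervalBrouwerAlgebra (hβ Set.univ).2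
      letI β : (Set I)ᵒᵈ → Set.Icc (u Set.univ ⊓ d) (u ∅ ⊓ d) :=
        fun X => ⟨u (OrderDual.ofDual X) ⊓ d, hβ _⟩
      IsUpperImplicativeEmbedding β ∧ IsCanonical (Set.range β) := by
  have anti : ∀ X Y, X ⊆ Y → u Y ≤ u X := fun X Y h => by
    have := u_inter X Y
    rw [Set.inter_eq_left.2 h] at this
    exact this ▸ le_sup_right
  have hβ : ∀ X : Set I, u X ⊓ d ∈ Set.Icc (u Set.univ ⊓ d) (u ∅ ⊓ d) := fun X =>
    ⟨inf_le_inf_right d (anti _ _ (Set.subset_univ X)),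
      inf_le_inf_right d (anti _ _ (Set.empty_subset X))⟩
  -- Since `d` is not below `u Y`, primeness of `u Y` cancels `d`.
  have le_imp : ∀ X Y, u X ⊓ d ≤ u Y ⊓ d → Y ⊆ X := fun X Y h =>
    sub X Y ((prime Y _ _ (h.trans inf_le_left)).resolve_right (not_le Y))
  have sdiff_inf_d : ∀ X, ∀ y ≤ d, y \ (u X ⊓ d) = y \ u X := fun X y hy => by
    rw [sdiff_inf, sdiff_eq_bot_iff.2 hy, sup_bot_eq]
  refine ⟨hβ, ?_⟩
  let := intervalBrouwerAlgebra (hβ Set.univ).2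
  have emb : IsUpperImplicativeEmbedding
      (fun X => ⟨u (OrderDual.ofDual X) ⊓ d, hβ _⟩ :
        (Set I)ᵒᵈ → Set.Icc (u Set.univ ⊓ d) (u ∅ ⊓ d)) := by
    refine ⟨fun X Y h => ?_, fun X Y => Subtype.ext ?_, fun X Y => Subtype.ext ?_, rfl, rfl⟩
    · have h' := congrArg Subtype.val h
      exact Set.Subset.antisymm (a := OrderDual.ofDual X) (b := OrderDual.ofDual Y)
        (le_imp _ _ (le_of_eq h'.symm)) (le_imp _ _ (le_of_eq h'))
    · change u (OrderDual.ofDual X ∩ OrderDual.ofDual Y) ⊓ d = _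
      rw [u_inter, inf_sup_right]
      rfl
    · have e : (OrderDual.ofDual (brouwerImp X Y) : Set I) =
          (OrderDual.ofDual X)ᶜ ∪ OrderDual.ofDual Y := by
        change OrderDual.ofDual X ⇨ OrderDual.ofDual Y = _
        rw [himp_eq]
        exact Set.union_comm _ _
      change u (OrderDual.ofDual (brouwerImp X Y)) ⊓ d =
        (u (OrderDual.ofDual Y) ⊓ d) \ (u (OrderDual.ofDual X) ⊓ d) ⊔ u Set.univ ⊓ d
      rw [e, sdiff_inf_d _ _ inf_le_right, inf_sdiff_u, d_sdiff, ← inf_sup_right, u_imp]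
  refine ⟨emb, isCanonical_range emb ?_ ?_⟩
  · intro X b c h
    have h' : u (OrderDual.ofDual X) ⊓ d = b.1 ⊓ c.1 := congrArg Subtype.val h
    -- Primeness puts one factor below `u X`; the interval puts it below `d`.
    refine (prime _ _ _ (h' ▸ inf_le_left)).imp (fun hb => ?_) fun hc => ?_
    · exact Subtype.ext (le_antisymm (h'.trans_le inf_le_left)
        (le_inf hb (b.2.2.trans inf_le_right)))
    · exact Subtype.ext (le_antisymm (h'.trans_le inf_le_right)
        (le_inf hc (c.2.2.trans inf_le_right)))
  · intro X b c
    refine Subtype.ext ?_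
    have hb : b.1 ≤ d := b.2.2.trans inf_le_right
    have hc : c.1 ≤ d := c.2.2.trans inf_le_right
    change (b.1 ⊓ c.1) \ (u (OrderDual.ofDual X) ⊓ d) ⊔ u Set.univ ⊓ d =
      (b.1 \ (u (OrderDual.ofDual X) ⊓ d) ⊔ u Set.univ ⊓ d) ⊓
        (c.1 \ (u (OrderDual.ofDual X) ⊓ d) ⊔ u Set.univ ⊓ d)
    rw [sdiff_inf_d _ _ (inf_le_left.trans hb), sdiff_inf_d _ _ hb, sdiff_inf_d _ _ hc,
      inf_sdiff_u, sup_inf_right]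

end Medvedev

/-! ### Application to the Medvedev lattice -/

theorem mainTheorem5 {I : Type*} (A B E : Set (ℕ → ℕ)) (f : I → ℕ → ℕ)
    (hEB : ¬ Medvedev.MedvedevLE B E)
    (hA : Medvedev.IsTuringDownwardClosed A)
    (hEA : E ⊆ Aᶜ)
    (hf : Medvedev.IsStrongUpwardsAntichain A f) :
    ∃ hβ : ∀ X : Set I, Medvedev.deg (Medvedev.betaProblem A B E f X) ∈
        Set.Icc (Medvedev.deg (Medvedev.betaProblem A B E f Set.univ))
          (Medvedev.deg (Medvedev.betaProblem A B E f ∅)),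
      letI := Medvedev.intervalBrouwerAlgebra (hβ Set.univ).2
      letI β : (Set I)ᵒᵈ → Set.Icc (Medvedev.deg (Medvedev.betaProblem A B E f Set.univ))
          (Medvedev.deg (Medvedev.betaProblem A B E f ∅)) :=
        fun X => ⟨Medvedev.deg (Medvedev.betaProblem A B E f (OrderDual.ofDual X)), hβ _⟩
      Medvedev.IsUpperImplicativeEmbedding β ∧ Medvedev.IsCanonical (Set.range β) := by
  have up := fun X : Set I =>
    Medvedev.isTuringUpwardClosed_compl_union_upperCone hA (f '' X)
  have hE : ∀ X : Set I, Medvedev.deg (Aᶜ ∪ Medvedev.upperCone (f '' X)) ≤ Medvedev.deg E :=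
    fun X => Medvedev.medvedevLE_of_subset (hEA.trans Set.subset_union_left)
  refine Medvedev.embedding_of_prime
    (fun X => Medvedev.deg (Aᶜ ∪ Medvedev.upperCone (f '' X))) (Medvedev.deg B \ Medvedev.deg E)
    (fun X b c => Medvedev.le_deg_or_le_deg_of_inf_le (up X))
    (fun X => Medvedev.deg_inf_sdiff_of_upwardClosed (up X)) (fun X Y => ?_)
    (Medvedev.deg_sdiff_sup_deg_univ hA hf) (fun X Y => Medvedev.subset_of_deg_le hA hf)
    (fun X => ?_) (fun X h => hEB ?_)
  · rw [Medvedev.deg_sup_of_upwardClosed (up X) (up Y),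
      Medvedev.compl_union_upperCone_inter hA hf]
  -- Currying: `U_X → (E → B)` is `(E ⊕ U_X) → B`, and `E` absorbs `U_X`.
  · rw [sdiff_sdiff, sup_eq_left.2 (hE X)]
  -- From `E → B ≤ U_X ≤ E` the adjunction gives `B ≤ E ⊕ E`, which is `E`.
  · simpa only [sdiff_le_iff, sup_idem, Medvedev.deg_le_deg] using h.trans (hE X)
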